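/- Fix $n\ge 1$ and let $e_1,\dots,e_n$ be the standard basis of $\mathbb R^n$. Let $\Diamond^n=\{x\in\mathbb R^n:\sum_i|x_i|\le 1\}$ be the octahedron, with extreme points $\operatorname{ext}(\Diamond^n)=\{\pm e_1,\dots,\pm e_n\}$, and let $\square^n=\{x\in\mathbb R^n:\max_i|x_i|\le 1\}$ be the cube. A triangulation $T$ of $X\subset\mathbb R^n$ is a finite family of simplices with union $X$ that contains every face of each of its members and in which any two simplices meet in a common (possibly empty) face; $V(T)$ is its set of vertices. Given $\lambda:V(T)\to\operatorname{ext}(\Diamond^n)$, a complementary edge of $T$ is a pair of vertices $v_1,v_2$ of one simplex of $T$ with $\lambda(v_1)=-\lambda(v_2)$. Consider the following two assertions in dimension $n$. (A) (Octahedral Sperner with Octahedral Labels.) Let $T$ be a triangulation of $\Diamond^n$ and let $\lambda:V(T)\to\operatorname{ext}(\Diamond^n)$ be such that for all $x\in V(T)\cap\partial(\Diamond^n)$ and all $1\le i\le n$: if $x_i\ge 0$ then $\lambda(x)\ne -e_i$, and if $x_i\le 0$ then $\lambda(x)\ne e_i$. Then $T$ contains a complementary edge. (B) (Cubical Sperner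 with Octahedral Labels.) Let $T$ be a triangulation of $\square^n$ and let $\lambda:V(T)\to\operatorname{ext}(\Diamond^n)$ be such that for all $x\in V(T)$ and all $1\le i\le n$: if $x_i\in\{-1,1\}$ then $\lambda(x)\ne -x_ie_i$. Then $T$ contains a complementary edge. Theorem. For every $n\ge 1$, (A) in dimension $n$ implies (B) in dimension $n$. -/

import Mathlib

namespace SpernerLabels

/-- The `n`-dimensional octahedron (cross-polytope): the closed unit ball of the `ℓ₁` norm. -/
def octahedron (n : ℕ) : Set (Fin n → ℝ) :=
  {x | ∑ i, |x i| ≤ 1}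

/-- The `n`-dimensional cube `[-1, 1]ⁿ`: the closed unit ball of the `ℓ_∞` norm. -/
def cube (n : ℕ) : Set (Fin n → ℝ) :=
  {x | ∀ i, |x i| ≤ 1}

/-- The `i`-th standard basis vector of `ℝⁿ`. -/
def stdVec {n : ℕ} (i : Fin n) : Fin n → ℝ :=
  Pi.single i 1

/-- The octahedral labels `{e₁, -e₁, …, eₙ, -eₙ}`, the extreme points of the octahedron. -/
def octLabels (n : ℕ) : Set (Fin n → ℝ) :=
  {l | ∃ i : Fin n, l = stdVec i ∨ l = -stdVec i}

/-- A triangulation of `X ⊆ ℝⁿ`: a finite geometric simplicial complex whose simplices have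
union exactly `X`. -/
def IsTriangulation {n : ℕ} (T : Geometry.SimplicialComplex ℝ (Fin n → ℝ))
    (X : Set (Fin n → ℝ)) : Prop :=
  T.faces.Finite ∧ T.space = X

/-- `lab` labels every vertex of `T` by an element of `{±e₁, …, ±eₙ}` (its values away from the
vertices of `T` are irrelevant). -/
def IsOctLabelling {n : ℕ} (T : Geometry.SimplicialComplex ℝ (Fin n → ℝ))
    (lab : (Fin n → ℝ) → (Fin n → ℝ)) : Prop :=
  ∀ v ∈ T.vertices, lab v ∈ octLabels n

/-- Some simplex of `T` has two vertices that carry opposite labels. -/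
def HasComplementaryEdge {n : ℕ} (T : Geometry.SimplicialComplex ℝ (Fin n → ℝ))
    (lab : (Fin n → ℝ) → (Fin n → ℝ)) : Prop :=
  ∃ s ∈ T.faces, ∃ v ∈ s, ∃ w ∈ s, lab v = -lab w

/-- Octahedral Sperner theorem with octahedral labels, in dimension `n`. -/
def OctahedralSperner (n : ℕ) : Prop :=
  ∀ (T : Geometry.SimplicialComplex ℝ (Fin n → ℝ)) (lab : (Fin n → ℝ) → (Fin n → ℝ)),
    IsTriangulation T (octahedron n) →
    IsOctLabelling T lab →
    (∀ x ∈ T.vertices, x ∈ frontier (octahedron n) → ∀ i : Fin n,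
      (0 ≤ x i → lab x ≠ -stdVec i) ∧ (x i ≤ 0 → lab x ≠ stdVec i)) →
    HasComplementaryEdge T lab

/-- Cubical Sperner theorem with octahedral labels, in dimension `n`. -/
def CubicalSperner (n : ℕ) : Prop :=
  ∀ (T : Geometry.SimplicialComplex ℝ (Fin n → ℝ)) (lab : (Fin n → ℝ) → (Fin n → ℝ)),
    IsTriangulation T (cube n) →
    IsOctLabelling T lab →
    (∀ x ∈ T.vertices, ∀ i : Fin n,
      (x i = 1 ∨ x i = -1) → lab x ≠ -(x i • stdVec i)) →
    HasComplementaryEdge T lab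

end SpernerLabels

/-! Shrink `T` by a factor `ε` with `n * ε < 1`, so that it fills a small cube inside the open
octahedron. Extend it to the whole octahedron by joining each face `ε • s` with the sets of pairwise
non-antipodal labels `l` whose facet `l ⬝ᵥ v = 1` contains `s`; for `s = ∅` these are the label
simplices themselves. Shrunk vertices keep their label, and each label labels itself. The boundary
hypothesis of (A) then holds, and (A) gives a complementary edge. No label takes part in it:
antipodal labels never share a simplex, and (B)'s hypothesis forbids `lab v = -l` on the facet of
`l`. So the edge comes from `T`.

The work is to show that the joins triangulate the octahedron. If the shrunk vertices carry total
weight `m` in a representation of `p`, the labels `±e_i` must carry the excess of `±p i` over `ε *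
m` (`IsCollarSimplex.label_weights`). The resulting total is strictly increasing in `m`, which
determines `m`; the remaining weights are unique because `T` is a complex
(`IsCollarSimplex.uniqueWeights`). Existence of `m` and of a decomposition gives covering
(`mem_collar_space`). -/

namespace SpernerLabels

open Finset

/-! ### Simplicial complexes through uniqueness of nonnegative weights. -/

section Weights

variable {E : Type*} [AddCommGroup E] [Module ℝ E]

/-- Nonnegative weights on `s` and on `t` with the same total and the same weighted sum of points
coincide. -/
def UniqueWeights (s t : Finset E) : Prop :=
  ∀ w w' : E → ℝ, (∀ x, 0 ≤ w x) → (∀ x, 0 ≤ w' x) → (∀ x ∉ s, w x = 0) → (∀ x ∉ t, w' x = 0) →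
    ∑ x ∈ s, w x = ∑ x ∈ t, w' x → ∑ x ∈ s, w x • x = ∑ x ∈ t, w' x • x → ∀ x, w x = w' x

/-- The positive and negative parts of an affine relation are nonnegative weights with equal totals
and equal sums, so they agree and the relation is trivial. -/
theorem UniqueWeights.affineIndependent {s : Finset E} (h : UniqueWeights s s) :
    AffineIndependent ℝ ((↑) : s → E) := by
  classical
  rw [affineIndependent_iff_of_fintype]
  intro w hw hs i
  rw [Finset.weightedVSub_eq_linear_combination _ hw] at hs
  set u : E → ℝ := fun x => if hx : x ∈ s then w ⟨x, hx⟩ else 0 with hu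
  have hui : ∀ i : s, w i = u i := fun i => by simp [hu]
  have h1 : ∑ x ∈ s, u x = 0 := by
    rw [← hw, ← Finset.sum_coe_sort]
    exact Finset.sum_congr rfl fun i _ => (hui i).symm
  have h2 : ∑ x ∈ s, u x • x = 0 := by
    rw [← hs, ← Finset.sum_coe_sort]
    exact Finset.sum_congr rfl fun i _ => by rw [hui]
  have hsplit : ∀ x, max (u x) 0 - max (-u x) 0 = u x := fun x => max_zero_sub_max_neg_zero_eq_self _
  have hu0 : ∀ x ∉ s, u x = 0 := fun x hx => by simp [hu, hx]
  have := h (fun x => max (u x) 0) (fun x => max (-u x) 0) (fun x => le_max_right _ _)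
    (fun x => le_max_right _ _) (fun x hx => by simp [hu0 x hx]) (fun x hx => by simp [hu0 x hx])
    (by rw [← sub_eq_zero, ← Finset.sum_sub_distrib]
        exact (Finset.sum_congr rfl fun x _ => hsplit x).trans h1)
    (by rw [← sub_eq_zero, ← Finset.sum_sub_distrib, ← h2]
        exact Finset.sum_congr rfl fun x _ => by rw [← sub_smul, hsplit x])
  rw [hui, ← hsplit, sub_eq_zero]
  exact this i

/-- The weights of a common point on `s` and on `t` coincide, hence are supported on `s ∩ t`. -/
theorem UniqueWeights.inter_subset_convexHull {s t : Finset E} (h : UniqueWeights s t) :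
    convexHull ℝ (s : Set E) ∩ convexHull ℝ (t : Set E) ⊆ convexHull ℝ (s ∩ t : Set E) := by
  classical
  rintro x ⟨hs, ht⟩
  obtain ⟨w, hw, hw1, hwx⟩ := Finset.mem_convexHull'.1 hs
  obtain ⟨w', hw', hw1', hwx'⟩ := Finset.mem_convexHull'.1 ht
  set a : E → ℝ := fun y => if y ∈ s then w y else 0 with ha
  set b : E → ℝ := fun y => if y ∈ t then w' y else 0 with hb
  have ha0 : ∀ y, 0 ≤ a y := fun y => by
    by_cases hy : y ∈ s
    · simpa [ha, hy] using hw y hy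
    · simp [ha, hy]
  have hb0 : ∀ y, 0 ≤ b y := fun y => by
    by_cases hy : y ∈ t
    · simpa [hb, hy] using hw' y hy
    · simp [hb, hy]
  have ha1 : ∑ y ∈ s, a y = 1 := by
    rw [← hw1]; exact Finset.sum_congr rfl fun y hy => by simp [ha, hy]
  have hb1 : ∑ y ∈ t, b y = 1 := by
    rw [← hw1']; exact Finset.sum_congr rfl fun y hy => by simp [hb, hy]
  have hax : ∑ y ∈ s, a y • y = x := by
    rw [← hwx]; exact Finset.sum_congr rfl fun y hy => by simp [ha, hy]
  have hbx : ∑ y ∈ t, b y • y = x := by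
    rw [← hwx']; exact Finset.sum_congr rfl fun y hy => by simp [hb, hy]
  have hab := h a b ha0 hb0 (fun y hy => by simp [ha, hy]) (fun y hy => by simp [hb, hy])
    (ha1.trans hb1.symm) (hax.trans hbx.symm)
  have hz : ∀ y ∈ s, y ∉ s ∩ t → a y = 0 := fun y hy hy' => by
    have : y ∉ t := fun h' => hy' (Finset.mem_inter.2 ⟨hy, h'⟩)
    rw [hab]; simp [hb, this]
  rw [← Finset.coe_inter, Finset.mem_convexHull']
  refine ⟨a, fun y _ => ha0 y, ?_, ?_⟩
  · rw [← ha1]; exact Finset.sum_subset Finset.inter_subset_left hz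
  · rw [← hax]
    exact Finset.sum_subset Finset.inter_subset_left fun y hy hy' => by rw [hz y hy hy', zero_smul]

/-- Weights on an affinely independent family are determined by their total and their weighted
sum. -/
theorem weights_eq_of_affineIndependent {s : Finset E}
    (h : AffineIndependent ℝ ((↑) : s → E)) {a c : E → ℝ}
    (h1 : ∑ x ∈ s, a x = ∑ x ∈ s, c x) (h2 : ∑ x ∈ s, a x • x = ∑ x ∈ s, c x • x) :
    ∀ x ∈ s, a x = c x := by
  intro x hx
  have h1' : ∑ i : s, (a i - c i) = 0 := by
    rw [Finset.sum_coe_sort s (fun i => a i - c i), Finset.sum_sub_distrib, h1, sub_self]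
  have := (affineIndependent_iff_of_fintype ℝ _).1 h (fun i => a i - c i) h1' (by
    rw [Finset.weightedVSub_eq_linear_combination _ h1',
      Finset.sum_coe_sort s (fun i => (a i - c i) • i)]
    simp only [sub_smul]
    rw [Finset.sum_sub_distrib, h2, sub_self]) ⟨x, hx⟩
  exact sub_eq_zero.1 this

/-- Converse of the two preceding criteria. Totals other than 1 are needed because the shrunk
vertices carry only part of the weight of a point. -/
theorem uniqueWeights_of_mem_faces (T : Geometry.SimplicialComplex ℝ E) {s t : Finset E}
    (hs : s ∈ T.faces) (ht : t ∈ T.faces) : UniqueWeights s t := by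
  classical
  intro w w' hw hw' hws hwt h1 h2
  set m := ∑ x ∈ s, w x with hm
  have hm0 : 0 ≤ m := Finset.sum_nonneg fun x _ => hw x
  rcases hm0.eq_or_lt with hm0 | hm0
  · have e1 := (Finset.sum_eq_zero_iff_of_nonneg fun x _ => hw x).1 (hm.symm.trans hm0.symm)
    have e2 := (Finset.sum_eq_zero_iff_of_nonneg fun x _ => hw' x).1 (h1.symm.trans hm0.symm)
    intro x
    have z1 : w x = 0 := by
      by_cases hx : x ∈ s
      · exact e1 x hx
      · exact hws x hx
    have z2 : w' x = 0 := by
      by_cases hx : x ∈ t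
      · exact e2 x hx
      · exact hwt x hx
    rw [z1, z2]
  · set q := m⁻¹ • ∑ x ∈ s, w x • x with hq
    have qs : q ∈ convexHull ℝ (s : Set E) := by
      rw [Finset.mem_convexHull']
      refine ⟨fun x => m⁻¹ * w x, fun x _ => mul_nonneg (inv_nonneg.2 hm0.le) (hw x), ?_, ?_⟩
      · rw [← Finset.mul_sum, ← hm, inv_mul_cancel₀ hm0.ne']
      · simp only [mul_smul]; rw [← Finset.smul_sum]
    have qt : q ∈ convexHull ℝ (t : Set E) := by
      rw [Finset.mem_convexHull']
      refine ⟨fun x => m⁻¹ * w' x, fun x _ => mul_nonneg (inv_nonneg.2 hm0.le) (hw' x), ?_, ?_⟩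
      · rw [← Finset.mul_sum, ← h1, inv_mul_cancel₀ hm0.ne']
      · simp only [mul_smul]; rw [← Finset.smul_sum, ← h2]
    have qst := T.inter_subset_convexHull hs ht ⟨qs, qt⟩
    rw [← Finset.coe_inter, Finset.mem_convexHull'] at qst
    obtain ⟨c, -, hc1, hcq⟩ := qst
    -- The weights of the normalised point on the common face, rescaled to total `m`; affine
    -- independence equates both `w` and `w'` with them.
    set d : E → ℝ := fun x => if x ∈ s ∩ t then m * c x else 0 with hd
    have hd1 : ∑ x ∈ s ∩ t, d x = m := by
      calc ∑ x ∈ s ∩ t, d x = ∑ x ∈ s ∩ t, m * c x :=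
            Finset.sum_congr rfl fun x hx => by simp only [hd, if_pos hx]
        _ = m := by rw [← Finset.mul_sum, hc1, mul_one]
    have hd2 : ∑ x ∈ s ∩ t, d x • x = ∑ x ∈ s, w x • x := by
      calc ∑ x ∈ s ∩ t, d x • x = ∑ x ∈ s ∩ t, m • c x • x :=
            Finset.sum_congr rfl fun x hx => by simp only [hd, if_pos hx, mul_smul]
        _ = _ := by rw [← Finset.smul_sum, hcq, hq, smul_inv_smul₀ hm0.ne']
    have hz : ∀ x ∉ s ∩ t, d x = 0 := fun x hx => by simp only [hd, if_neg hx]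
    have es := weights_eq_of_affineIndependent (T.indep hs) (a := w) (c := d)
      (by rw [← hm, ← hd1]
          exact Finset.sum_subset Finset.inter_subset_left fun x _ hx => hz x hx)
      (by rw [← hd2]
          exact Finset.sum_subset Finset.inter_subset_left fun x _ hx => by rw [hz x hx, zero_smul])
    have et := weights_eq_of_affineIndependent (T.indep ht) (a := w') (c := d)
      (by rw [← h1, ← hd1]
          exact Finset.sum_subset Finset.inter_subset_right fun x _ hx => hz x hx)
      (by rw [← h2, ← hd2]
          exact Finset.sum_subset Finset.inter_subset_right fun x _ hx => by rw [hz x hx, zero_smul])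
    have es' : ∀ x, w x = d x := fun x => by
      by_cases hx : x ∈ s
      · exact es x hx
      · rw [hws x hx, hz x fun h => hx (Finset.mem_inter.1 h).1]
    have et' : ∀ x, w' x = d x := fun x => by
      by_cases hx : x ∈ t
      · exact et x hx
      · rw [hwt x hx, hz x fun h => hx (Finset.mem_inter.1 h).2]
    intro x
    rw [es', et']

theorem UniqueWeights.empty_left {t : Finset E} : UniqueWeights ∅ t := by
  intro w w' _ hw' hws hwt h1 _ x
  rw [Finset.sum_empty] at h1
  have := (Finset.sum_eq_zero_iff_of_nonneg fun x _ => hw' x).1 h1.symm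
  rw [hws x (Finset.notMem_empty x)]
  by_cases hx : x ∈ t
  · exact (this x hx).symm
  · exact (hwt x hx).symm

theorem UniqueWeights.symm {s t : Finset E} (h : UniqueWeights s t) : UniqueWeights t s :=
  fun w w' hw hw' hwt hws h1 h2 x => (h w' w hw' hw hws hwt h1.symm h2.symm x).symm

end Weights

/-! ### Labels and collar simplices. -/

variable {n : ℕ}

theorem stdVec_apply (i j : Fin n) : stdVec i j = if j = i then (1 : ℝ) else 0 := by
  simp [stdVec, Pi.single_apply]

theorem stdVec_injective : Function.Injective (stdVec : Fin n → Fin n → ℝ) := fun i j h => by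
  by_contra hij
  have := congrFun h i
  simp [stdVec_apply, hij] at this

theorem stdVec_ne_neg_stdVec (i j : Fin n) : stdVec i ≠ -stdVec j := fun h => by
  have := congrFun h i
  by_cases hij : i = j <;> simp [stdVec_apply, hij] at this
  linarith

theorem stdVec_mem_octLabels (i : Fin n) : stdVec i ∈ octLabels n := ⟨i, Or.inl rfl⟩

theorem neg_stdVec_mem_octLabels (i : Fin n) : -stdVec i ∈ octLabels n := ⟨i, Or.inr rfl⟩

theorem stdVec_dotProduct (i : Fin n) (v : Fin n → ℝ) : stdVec i ⬝ᵥ v = v i := by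
  simp [stdVec]

/-- Every coordinate of `ε • v` has modulus below 1. This keeps shrunk vertices and labels apart. -/
theorem smul_notMem_octLabels {ε : ℝ} (h0 : 0 < ε) (h1 : ε < 1) {v : Fin n → ℝ}
    (hv : v ∈ cube n) : ε • v ∉ octLabels n := by
  rintro ⟨i, h | h⟩ <;>
  · have h2 := congrFun h i
    simp [stdVec_apply] at h2
    have := abs_le.1 (hv i)
    nlinarith

/-- `F` spans a face of the join of the simplex `ε • s` with the simplex of all labels `l` such
that `s` lies in the facet `{v | l ⬝ᵥ v = 1}` of the cube. -/
def IsCollarSimplex (ε : ℝ) (s F : Finset (Fin n → ℝ)) : Prop :=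
  ∀ x ∈ F, (x ∈ octLabels n ∧ -x ∉ F ∧ ∀ v ∈ s, x ⬝ᵥ v = 1) ∨ ∃ v ∈ s, x = ε • v

section Decomposition

variable {ε : ℝ} {s F : Finset (Fin n → ℝ)} {w : (Fin n → ℝ) → ℝ}

theorem IsCollarSimplex.sum_eq (hF : IsCollarSimplex ε s F) (h0 : 0 < ε) (h1 : ε < 1)
    (hs : ∀ v ∈ s, v ∈ cube n) (hw : ∀ x ∉ F, w x = 0) (f : (Fin n → ℝ) → ℝ) :
    ∑ x ∈ F, w x * f x = ∑ i, w (stdVec i) * f (stdVec i) + ∑ i, w (-stdVec i) * f (-stdVec i) +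
      ∑ v ∈ s, w (ε • v) * f (ε • v) := by
  classical
  set A := (univ : Finset (Fin n)).image stdVec with hA
  set B := (univ : Finset (Fin n)).image (fun i => -stdVec i) with hB
  set C := s.image (fun v => ε • v) with hC
  have hAB : Disjoint A B := by
    rw [Finset.disjoint_left]
    intro x hx hx'
    obtain ⟨i, -, rfl⟩ := Finset.mem_image.1 hx
    obtain ⟨j, -, h⟩ := Finset.mem_image.1 hx'
    exact stdVec_ne_neg_stdVec i j h.symm
  have hABC : Disjoint (A ∪ B) C := by
    rw [Finset.disjoint_left]
    intro x hx hx'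
    obtain ⟨v, hv, rfl⟩ := Finset.mem_image.1 hx'
    apply smul_notMem_octLabels h0 h1 (hs v hv)
    rcases Finset.mem_union.1 hx with hx | hx
    · obtain ⟨i, -, h⟩ := Finset.mem_image.1 hx
      exact ⟨i, Or.inl h.symm⟩
    · obtain ⟨i, -, h⟩ := Finset.mem_image.1 hx
      exact ⟨i, Or.inr h.symm⟩
  have hsub : F ⊆ A ∪ B ∪ C := by
    intro x hx
    rcases hF x hx with ⟨⟨i, rfl | rfl⟩, -⟩ | ⟨v, hv, rfl⟩
    · exact mem_union_left _ (mem_union_left _ (mem_image_of_mem _ (mem_univ i)))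
    · exact mem_union_left _ (mem_union_right _
        (mem_image_of_mem (fun i => -stdVec i) (mem_univ i)))
    · exact mem_union_right _ (mem_image_of_mem (fun v => ε • v) hv)
  rw [Finset.sum_subset hsub fun x _ hx => by rw [hw x hx, zero_mul], Finset.sum_union hABC,
    Finset.sum_union hAB, hA, hB, hC, Finset.sum_image stdVec_injective.injOn,
    Finset.sum_image (g := fun i => -stdVec i) (neg_injective.comp stdVec_injective).injOn,
    Finset.sum_image (smul_right_injective _ h0.ne').injOn]

/-- The total weight carried by the vertices `ε • v`, `v ∈ s`. -/
def coreWeight (ε : ℝ) (s : Finset (Fin n → ℝ)) (w : (Fin n → ℝ) → ℝ) : ℝ :=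
  ∑ v ∈ s, w (ε • v)

theorem IsCollarSimplex.sum_weight (hF : IsCollarSimplex ε s F) (h0 : 0 < ε) (h1 : ε < 1)
    (hs : ∀ v ∈ s, v ∈ cube n) (hw : ∀ x ∉ F, w x = 0) :
    ∑ x ∈ F, w x = ∑ i, (w (stdVec i) + w (-stdVec i)) + coreWeight ε s w := by
  have := hF.sum_eq h0 h1 hs hw (fun _ => 1)
  simp only [mul_one] at this
  rw [this, Finset.sum_add_distrib, coreWeight]

theorem IsCollarSimplex.sum_apply (hF : IsCollarSimplex ε s F) (h0 : 0 < ε) (h1 : ε < 1)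
    (hs : ∀ v ∈ s, v ∈ cube n) (hw : ∀ x ∉ F, w x = 0) (i : Fin n) :
    (∑ x ∈ F, w x • x) i =
      w (stdVec i) - w (-stdVec i) + ε * ∑ v ∈ s, w (ε • v) * v i := by
  have := hF.sum_eq h0 h1 hs hw (fun x => x i)
  rw [Finset.sum_apply]
  simp only [Pi.smul_apply, smul_eq_mul, Pi.neg_apply, stdVec_apply] at this ⊢
  rw [this, Finset.mul_sum]
  simp
  ring_nf

/-- The weights of the labels are the positive parts of the excess of the coordinates. -/
theorem IsCollarSimplex.label_weights (hF : IsCollarSimplex ε s F) (h0 : 0 < ε) (h1 : ε < 1)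
    (hs : ∀ v ∈ s, v ∈ cube n) (hw : ∀ x ∉ F, w x = 0) (hw0 : ∀ x, 0 ≤ w x) (i : Fin n) :
    w (stdVec i) = max ((∑ x ∈ F, w x • x) i - ε * coreWeight ε s w) 0 ∧
      w (-stdVec i) = max (-(∑ x ∈ F, w x • x) i - ε * coreWeight ε s w) 0 := by
  have hp := hF.sum_apply h0 h1 hs hw i
  set p := (∑ x ∈ F, w x • x) i
  set S := ∑ v ∈ s, w (ε • v) * v i with hS
  have hm0 : 0 ≤ coreWeight ε s w := Finset.sum_nonneg fun v _ => hw0 _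
  have hS1 : S ≤ coreWeight ε s w := Finset.sum_le_sum fun v hv => by
    nlinarith [hw0 (ε • v), (abs_le.1 (hs v hv i)).2]
  have hS2 : -coreWeight ε s w ≤ S := by
    rw [coreWeight, ← Finset.sum_neg_distrib]
    exact Finset.sum_le_sum fun v hv => by nlinarith [hw0 (ε • v), (abs_le.1 (hs v hv i)).1]
  have he1 : ε * S ≤ ε * coreWeight ε s w := mul_le_mul_of_nonneg_left hS1 h0.le
  have he2 : -(ε * coreWeight ε s w) ≤ ε * S := by
    rw [← mul_neg]; exact mul_le_mul_of_nonneg_left hS2 h0.le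
  have hem : 0 ≤ ε * coreWeight ε s w := mul_nonneg h0.le hm0
  have a0 := hw0 (stdVec i)
  have b0 := hw0 (-stdVec i)
  -- A label in `F` excludes its antipode and forces `S = ±m`, with `m` the core weight; with
  -- neither label in `F`, `|p i| ≤ ε * m` and both excesses vanish.
  by_cases ha : stdVec i ∈ F
  · have hb : w (-stdVec i) = 0 := by
      rcases hF _ ha with ⟨-, h, -⟩ | ⟨v, hv, h⟩
      · exact hw _ h
      · exact absurd (h ▸ stdVec_mem_octLabels i) (smul_notMem_octLabels h0 h1 (hs v hv))
    have hSm : S = coreWeight ε s w := Finset.sum_congr rfl fun v hv => by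
      rcases hF _ ha with ⟨-, -, h⟩ | ⟨u, hu, h⟩
      · have := h v hv
        rw [stdVec_dotProduct] at this
        rw [this, mul_one]
      · exact absurd (h ▸ stdVec_mem_octLabels i) (smul_notMem_octLabels h0 h1 (hs u hu))
    rw [hSm] at hp
    constructor
    · rw [max_eq_left] <;> linarith
    · rw [max_eq_right] <;> linarith
  · have ha' := hw _ ha
    by_cases hb : -stdVec i ∈ F
    · have hSm : S = -coreWeight ε s w := by
        rw [coreWeight, ← Finset.sum_neg_distrib]
        refine Finset.sum_congr rfl fun v hv => ?_
        rcases hF _ hb with ⟨-, -, h⟩ | ⟨u, hu, h⟩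
        · have := h v hv
          rw [neg_dotProduct, stdVec_dotProduct] at this
          rw [neg_eq_iff_eq_neg.1 this, mul_neg, mul_one]
        · exact absurd (h ▸ neg_stdVec_mem_octLabels i) (smul_notMem_octLabels h0 h1 (hs u hu))
      rw [hSm] at hp
      constructor
      · rw [max_eq_right] <;> linarith
      · rw [max_eq_left] <;> linarith
    · have hb' := hw _ hb
      constructor
      · rw [max_eq_right] <;> linarith
      · rw [max_eq_right] <;> linarith

end Decomposition

/-! ### Uniqueness of weights across two collar simplices. -/

/-- Decreasing `m` by `δ` increases the excess of `p` over `[-ε m, ε m]` by at most `ε δ`. -/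
theorem excess_le {ε m m' : ℝ} (h0 : 0 < ε) (hm : 0 ≤ m) (h : m ≤ m') (p : ℝ) :
    max (p - ε * m) 0 + max (-p - ε * m) 0 ≤
      max (p - ε * m') 0 + max (-p - ε * m') 0 + ε * (m' - m) := by
  have e1 : 0 ≤ ε * m := mul_nonneg h0.le hm
  have e2 : ε * m ≤ ε * m' := mul_le_mul_of_nonneg_left h h0.le
  have l1 := le_max_left (p - ε * m') 0
  have l2 := le_max_right (p - ε * m') 0
  have l3 := le_max_left (-p - ε * m') 0
  have l4 := le_max_right (-p - ε * m') 0
  rcases max_cases (p - ε * m) 0 with ⟨h1, _⟩ | ⟨h1, _⟩ <;>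
  rcases max_cases (-p - ε * m) 0 with ⟨h2, _⟩ | ⟨h2, _⟩ <;> rw [h1, h2] <;> nlinarith

/-- Raising `m` by `δ` lowers the `n` excesses by at most `n * ε * δ < δ` in all, so the total is
strictly increasing in `m`. -/
theorem eq_of_sum_excess_eq {ε m m' : ℝ} (h0 : 0 < ε) (hε : n * ε < 1) (hm : 0 ≤ m) (hm' : 0 ≤ m')
    (p : Fin n → ℝ)
    (h : ∑ i, (max (p i - ε * m) 0 + max (-p i - ε * m) 0) + m =
      ∑ i, (max (p i - ε * m') 0 + max (-p i - ε * m') 0) + m') : m = m' := by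
  have key : ∀ a b : ℝ, 0 ≤ a → a ≤ b →
      ∑ i, (max (p i - ε * a) 0 + max (-p i - ε * a) 0) + a =
      ∑ i, (max (p i - ε * b) 0 + max (-p i - ε * b) 0) + b → a = b := by
    intro a b ha hab h
    have := Finset.sum_le_sum fun i (_ : i ∈ univ) => excess_le h0 ha hab (p i)
    rw [Finset.sum_add_distrib (g := fun _ => ε * (b - a)), Finset.sum_const, Finset.card_univ,
      Fintype.card_fin, nsmul_eq_mul] at this
    by_contra hne
    have hlt : a < b := lt_of_le_of_ne hab hne
    nlinarith
  rcases le_total m m' with hmm | hmm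
  · exact key m m' hm hmm h
  · exact (key m' m hm' hmm h.symm).symm

theorem IsCollarSimplex.uniqueWeights {ε : ℝ} {s t F G : Finset (Fin n → ℝ)}
    (h0 : 0 < ε) (h1 : ε < 1) (hε : n * ε < 1) (hF : IsCollarSimplex ε s F)
    (hG : IsCollarSimplex ε t G) (hs : ∀ v ∈ s, v ∈ cube n) (ht : ∀ v ∈ t, v ∈ cube n)
    (hst : UniqueWeights s t) : UniqueWeights F G := by
  classical
  intro w w' hw hw' hwF hwG e1 e2
  have lF := hF.label_weights h0 h1 hs hwF hw
  have lG := hG.label_weights h0 h1 ht hwG hw'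
  rw [← e2] at lG
  have hm : coreWeight ε s w = coreWeight ε t w' := by
    refine eq_of_sum_excess_eq h0 hε (Finset.sum_nonneg fun v _ => hw _)
      (Finset.sum_nonneg fun v _ => hw' _) (∑ x ∈ F, w x • x) ?_
    rw [hF.sum_weight h0 h1 hs hwF, hG.sum_weight h0 h1 ht hwG] at e1
    simp only [fun i => (lF i).1, fun i => (lF i).2, fun i => (lG i).1, fun i => (lG i).2] at e1
    exact e1
  have hpos : ∀ i, w (stdVec i) = w' (stdVec i) := fun i => by rw [(lF i).1, (lG i).1, hm]
  have hneg : ∀ i, w (-stdVec i) = w' (-stdVec i) := fun i => by rw [(lF i).2, (lG i).2, hm]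
  -- The cutoff matters: for `v = ε⁻¹ • stdVec i` the point `ε • v` is a label and may carry weight.
  have hab := hst (fun v => if v ∈ s then w (ε • v) else 0) (fun v => if v ∈ t then w' (ε • v) else 0)
    (fun v => by split_ifs; exacts [hw _, le_rfl])
    (fun v => by split_ifs; exacts [hw' _, le_rfl])
    (fun v hv => if_neg hv) (fun v hv => if_neg hv)
    (by
      rw [Finset.sum_congr rfl fun v hv => if_pos hv, Finset.sum_congr rfl fun v hv => if_pos hv]
      exact hm)
    (by
      have c1 : ∑ v ∈ s, (if v ∈ s then w (ε • v) else 0) • v = ∑ v ∈ s, w (ε • v) • v :=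
        Finset.sum_congr rfl fun v hv => by rw [if_pos hv]
      have c2 : ∑ v ∈ t, (if v ∈ t then w' (ε • v) else 0) • v = ∑ v ∈ t, w' (ε • v) • v :=
        Finset.sum_congr rfl fun v hv => by rw [if_pos hv]
      rw [c1, c2]
      ext i
      have p1 := hF.sum_apply h0 h1 hs hwF i
      have p2 := hG.sum_apply h0 h1 ht hwG i
      rw [← e2, p1, hpos, hneg, add_right_inj] at p2
      rw [Finset.sum_apply, Finset.sum_apply]
      exact mul_left_cancel₀ h0.ne' p2)
  intro x
  by_cases hx : x ∈ octLabels n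
  · obtain ⟨i, rfl | rfl⟩ := hx
    exacts [hpos i, hneg i]
  · have hex : ε • (ε⁻¹ • x) = x := smul_inv_smul₀ h0.ne' x
    have aux : ∀ {s F : Finset (Fin n → ℝ)} {w : (Fin n → ℝ) → ℝ}, IsCollarSimplex ε s F →
        (∀ x ∉ F, w x = 0) → (if ε⁻¹ • x ∈ s then w (ε • (ε⁻¹ • x)) else 0) = w x := by
      intro s F w hF hwF
      rw [hex]
      split_ifs with hxs
      · rfl
      · refine (hwF x fun hxF => ?_).symm
        rcases hF x hxF with h | ⟨v, hv, rfl⟩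
        · exact hx h.1
        · rw [inv_smul_smul₀ h0.ne'] at hxs
          exact hxs hv
    rw [← aux hF hwF, ← aux hG hwG]
    exact hab (ε⁻¹ • x)

theorem collarSimplex_anti {ε : ℝ} {s F G : Finset (Fin n → ℝ)} (hF : IsCollarSimplex ε s F)
    (hGF : G ⊆ F) : IsCollarSimplex ε s G := fun x hx =>
  (hF x (hGF hx)).imp_left fun h => ⟨h.1, fun h' => h.2.1 (hGF h'), h.2.2⟩

/-! ### The collar complex. -/

/-- A possibly empty face of `T`. -/
def IsFaceOrEmpty (T : Geometry.SimplicialComplex ℝ (Fin n → ℝ)) (s : Finset (Fin n → ℝ)) : Prop :=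
  s = ∅ ∨ s ∈ T.faces

variable {T : Geometry.SimplicialComplex ℝ (Fin n → ℝ)}

theorem IsFaceOrEmpty.subset_cube (hT : T.space = cube n) {s : Finset (Fin n → ℝ)}
    (hs : IsFaceOrEmpty T s) : ∀ v ∈ s, v ∈ cube n := by
  intro v hv
  rcases hs with rfl | hs
  · exact absurd hv (Finset.notMem_empty v)
  · exact hT ▸ Geometry.SimplicialComplex.subset_space hs hv

theorem IsFaceOrEmpty.mem_faces {s : Finset (Fin n → ℝ)} (hs : IsFaceOrEmpty T s)
    {v : Fin n → ℝ} (hv : v ∈ s) : s ∈ T.faces :=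
  hs.resolve_left (Finset.ne_empty_of_mem hv)

theorem IsFaceOrEmpty.mem_vertices {s : Finset (Fin n → ℝ)} (hs : IsFaceOrEmpty T s)
    {v : Fin n → ℝ} (hv : v ∈ s) : v ∈ T.vertices :=
  T.down_closed (hs.mem_faces hv) (Finset.singleton_subset_iff.2 hv) (Finset.singleton_nonempty v)

theorem IsFaceOrEmpty.uniqueWeights {s t : Finset (Fin n → ℝ)}
    (hs : IsFaceOrEmpty T s) (ht : IsFaceOrEmpty T t) : UniqueWeights s t := by
  rcases hs with rfl | hs
  · exact UniqueWeights.empty_left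
  rcases ht with rfl | ht
  · exact UniqueWeights.empty_left.symm
  exact uniqueWeights_of_mem_faces T hs ht

/-- The simplices of the extension of `ε • T` by joins with simplices of labels. -/
def collarFaces (T : Geometry.SimplicialComplex ℝ (Fin n → ℝ)) (ε : ℝ) :
    Set (Finset (Fin n → ℝ)) :=
  {F | F.Nonempty ∧ ∃ s, IsFaceOrEmpty T s ∧ IsCollarSimplex ε s F}

theorem uniqueWeights_of_mem_collarFaces (hT : T.space = cube n) {ε : ℝ} (h0 : 0 < ε) (h1 : ε < 1)
    (hε : n * ε < 1) {F G : Finset (Fin n → ℝ)} (hF : F ∈ collarFaces T ε)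
    (hG : G ∈ collarFaces T ε) : UniqueWeights F G := by
  obtain ⟨-, s, hs, hF⟩ := hF
  obtain ⟨-, t, ht, hG⟩ := hG
  exact hF.uniqueWeights h0 h1 hε hG (hs.subset_cube hT) (ht.subset_cube hT) (hs.uniqueWeights ht)

/-- A triangulation `T` of the cube, shrunk by `ε` and extended by joins of its boundary simplices
with simplices of labels. -/
def collarComplex (T : Geometry.SimplicialComplex ℝ (Fin n → ℝ)) (hT : T.space = cube n) (ε : ℝ)
    (h0 : 0 < ε) (h1 : ε < 1) (hε : n * ε < 1) :
    Geometry.SimplicialComplex ℝ (Fin n → ℝ) where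
  faces := collarFaces T ε
  isRelLowerSet_faces := by
    rintro F ⟨hne, s, hs, hF⟩
    exact ⟨hne, fun G hGF hG => ⟨hG, s, hs, collarSimplex_anti hF hGF⟩⟩
  indep hF := (uniqueWeights_of_mem_collarFaces hT h0 h1 hε hF hF).affineIndependent
  inter_subset_convexHull hF hG :=
    (uniqueWeights_of_mem_collarFaces hT h0 h1 hε hF hG).inter_subset_convexHull

theorem octLabels_finite : (octLabels n).Finite := by
  refine ((Set.finite_range (stdVec : Fin n → Fin n → ℝ)).union
    (Set.finite_range (fun i : Fin n => -(stdVec i : Fin n → ℝ)))).subset ?_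
  rintro x ⟨i, rfl | rfl⟩
  exacts [Or.inl ⟨i, rfl⟩, Or.inr ⟨i, rfl⟩]

theorem collarFaces_finite (hT : T.faces.Finite) (ε : ℝ) : (collarFaces T ε).Finite := by
  classical
  have hV : (octLabels n ∪ (fun v => ε • v) '' T.vertices).Finite := by
    refine octLabels_finite.union (Set.Finite.image _ ?_)
    rw [Geometry.SimplicialComplex.vertices_eq]
    exact hT.biUnion fun s _ => s.finite_toSet
  refine (hV.toFinset.powerset.finite_toSet).subset ?_
  rintro F ⟨-, s, hs, hF⟩
  rw [Finset.mem_coe, Finset.mem_powerset]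
  intro x hx
  rw [Set.Finite.mem_toFinset]
  rcases hF x hx with h | ⟨v, hv, rfl⟩
  · exact Or.inl h.1
  · exact Or.inr ⟨v, hs.mem_vertices hv, rfl⟩

/-! ### The collar complex fills the octahedron. -/

theorem convex_octahedron : Convex ℝ (octahedron n) := by
  intro x hx y hy a b ha hb hab
  calc ∑ i, |(a • x + b • y) i| ≤ ∑ i, (a * |x i| + b * |y i|) :=
        Finset.sum_le_sum fun i _ => by
          simp only [Pi.add_apply, Pi.smul_apply, smul_eq_mul]
          refine (abs_add_le _ _).trans ?_
          rw [abs_mul, abs_mul, abs_of_nonneg ha, abs_of_nonneg hb]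
    _ = a * ∑ i, |x i| + b * ∑ i, |y i| := by
        rw [Finset.sum_add_distrib, Finset.mul_sum, Finset.mul_sum]
    _ ≤ a * 1 + b * 1 := add_le_add (mul_le_mul_of_nonneg_left hx ha)
        (mul_le_mul_of_nonneg_left hy hb)
    _ = 1 := by rw [mul_one, mul_one, hab]

theorem octLabels_subset_octahedron : octLabels n ⊆ octahedron n := by
  rintro x ⟨i, rfl | rfl⟩ <;> simp [octahedron, stdVec_apply, apply_ite abs]

theorem sum_abs_smul_lt_one {ε : ℝ} (h0 : 0 < ε) (hε : n * ε < 1) {v : Fin n → ℝ}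
    (hv : v ∈ cube n) : ∑ i, |(ε • v) i| < 1 := by
  refine lt_of_le_of_lt (Finset.sum_le_card_nsmul univ _ ε fun i _ => ?_) (by simpa using hε)
  rw [Pi.smul_apply, smul_eq_mul, abs_mul, abs_of_pos h0]
  exact mul_le_of_le_one_right h0.le (hv i)

theorem notMem_frontier_octahedron {x : Fin n → ℝ} (hx : ∑ i, |x i| < 1) :
    x ∉ frontier (octahedron n) := by
  intro h
  refine h.2 (mem_interior.2 ⟨{y | ∑ i, |y i| < 1}, fun y hy => (show ∑ i, |y i| < 1 from hy).le, ?_, hx⟩)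
  exact isOpen_lt (by fun_prop) continuous_const

/-- The cone of height `m` over the cube decomposes along the triangulation `T`, with positive
weights. -/
theorem exists_cone_weights (hT : T.space = cube n) {m : ℝ} (hm : 0 ≤ m) {y : Fin n → ℝ}
    (hy : ∀ i, |y i| ≤ m) :
    ∃ s, IsFaceOrEmpty T s ∧ ∃ c : (Fin n → ℝ) → ℝ, (∀ v ∈ s, 0 < c v) ∧ ∑ v ∈ s, c v = m ∧
      ∑ v ∈ s, c v • v = y := by
  classical
  rcases hm.eq_or_lt with rfl | hm
  -- Height 0 is the case of points lying in a simplex of labels alone.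
  · refine ⟨∅, Or.inl rfl, 0, by simp, by simp, ?_⟩
    ext i
    simpa using (abs_nonpos_iff.1 (hy i)).symm
  · have hu : m⁻¹ • y ∈ T.space := by
      rw [hT]
      intro i
      rw [Pi.smul_apply, smul_eq_mul, abs_mul, abs_of_pos (inv_pos.2 hm), inv_mul_le_iff₀ hm,
        mul_one]
      exact hy i
    obtain ⟨s, hs, hus⟩ := Geometry.SimplicialComplex.mem_space_iff.1 hu
    obtain ⟨c, hc, hc1, hcu⟩ := Finset.mem_convexHull'.1 hus
    -- Vertices of weight zero are dropped: they need not lie in the facets that contain the point.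
    have hz : ∀ v ∈ s, v ∉ s.filter (fun v => 0 < c v) → c v = 0 := fun v hv hv' =>
      le_antisymm (not_lt.1 fun h => hv' (Finset.mem_filter.2 ⟨hv, h⟩)) (hc v hv)
    have hf1 : ∑ v ∈ s.filter (fun v => 0 < c v), c v = 1 := by
      rw [← hc1]; exact Finset.sum_subset (Finset.filter_subset _ _) hz
    have hfu : ∑ v ∈ s.filter (fun v => 0 < c v), c v • v = m⁻¹ • y := by
      rw [← hcu]
      exact Finset.sum_subset (Finset.filter_subset _ _) fun v hv hv' => by
        rw [hz v hv hv', zero_smul]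
    refine ⟨s.filter (fun v => 0 < c v), Or.inr (T.down_closed hs (Finset.filter_subset _ _) ?_),
      fun v => m * c v, fun v hv => mul_pos hm (Finset.mem_filter.1 hv).2, ?_, ?_⟩
    · refine Finset.nonempty_of_sum_ne_zero (f := c) ?_
      rw [hf1]; exact one_ne_zero
    · rw [← Finset.mul_sum, hf1, mul_one]
    · simp only [mul_smul]
      rw [← Finset.smul_sum, hfu, smul_inv_smul₀ hm.ne']

theorem eq_one_of_weighted_sum_eq {ι : Type*} {s : Finset ι} {c f : ι → ℝ} (hc : ∀ v ∈ s, 0 < c v)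
    (hf : ∀ v ∈ s, f v ≤ 1) (h : ∑ v ∈ s, c v * f v = ∑ v ∈ s, c v) : ∀ v ∈ s, f v = 1 := by
  intro v hv
  have := (Finset.sum_eq_sum_iff_of_le fun v hv => mul_le_of_le_one_right (hc v hv).le (hf v hv)).1
    h v hv
  exact (mul_eq_left₀ (hc v hv).ne').1 this

/-- Intermediate values: the expression is the `ℓ₁` norm of `x` at `m = 0` and at least 1 at `m =
1`. -/
theorem exists_core_weight {ε : ℝ} {x : Fin n → ℝ} (hx : x ∈ octahedron n) :
    ∃ m : ℝ, 0 ≤ m ∧ ∑ i, max (|x i| - ε * m) 0 + m = 1 := by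
  set f : ℝ → ℝ := fun m => ∑ i, max (|x i| - ε * m) 0 + m with hf
  have hcont : ContinuousOn f (Set.Icc 0 1) := by
    apply Continuous.continuousOn
    fun_prop
  have hf0 : f 0 ≤ 1 := by
    simpa [hf] using (show ∑ i, |x i| ≤ 1 from hx)
  have hf1 : 1 ≤ f 1 :=
    le_add_of_nonneg_left (Finset.sum_nonneg fun i _ => le_max_right _ _)
  obtain ⟨m, hm, h⟩ := intermediate_value_Icc zero_le_one hcont ⟨hf0, hf1⟩
  exact ⟨m, hm.1, h⟩

/-- The label `± e_i` on the side of `x`. -/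
noncomputable def signVec (x : Fin n → ℝ) (i : Fin n) : Fin n → ℝ :=
  if 0 < x i then stdVec i else -stdVec i

theorem signVec_mem_octLabels (x : Fin n → ℝ) (i : Fin n) : signVec x i ∈ octLabels n := by
  unfold signVec
  split_ifs
  exacts [stdVec_mem_octLabels i, neg_stdVec_mem_octLabels i]

theorem signVec_apply_of_ne (x : Fin n → ℝ) {i j : Fin n} (h : j ≠ i) : signVec x i j = 0 := by
  unfold signVec
  split_ifs <;> simp [stdVec_apply, h]

theorem neg_mem_octLabels {x : Fin n → ℝ} (hx : x ∈ octLabels n) : -x ∈ octLabels n := by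
  obtain ⟨i, rfl | rfl⟩ := hx
  · exact neg_stdVec_mem_octLabels i
  · rw [neg_neg]; exact stdVec_mem_octLabels i

theorem neg_signVec_ne (x : Fin n → ℝ) (i j : Fin n) : -signVec x i ≠ signVec x j := by
  unfold signVec
  split_ifs with h1 h2 h2
  · exact fun h => stdVec_ne_neg_stdVec j i h.symm
  · exact fun h => h2 (stdVec_injective (neg_injective h) ▸ h1)
  · rw [neg_neg]; exact fun h => h1 (stdVec_injective h ▸ h2)
  · rw [neg_neg]; exact stdVec_ne_neg_stdVec i j

/-- Clip each coordinate of `x` to `[-ε * m, ε * m]`. The amounts cut off are the label weights `t`;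
the clipped point, divided by `ε`, lies in `m` times the cube and decomposes along `T`. Where
something was cut off the clipped coordinate is extremal, which puts all of `s` in that facet. -/
theorem mem_collar_space (hT : T.space = cube n) {ε : ℝ} (h0 : 0 < ε) (h1 : ε < 1)
    {x : Fin n → ℝ} (hx : x ∈ octahedron n) :
    ∃ F ∈ collarFaces T ε, x ∈ convexHull ℝ (F : Set (Fin n → ℝ)) := by
  classical
  obtain ⟨m, hm, hsum⟩ := exists_core_weight (ε := ε) hx
  have hem : 0 ≤ ε * m := mul_nonneg h0.le hm
  set t : Fin n → ℝ := fun i => max (|x i| - ε * m) 0 with ht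
  have ht0 : ∀ i, 0 ≤ t i := fun i => le_max_right _ _
  have hsv : ∀ i, t i * signVec x i i = if 0 < x i then t i else -t i := fun i => by
    unfold signVec; split_ifs <;> simp [stdVec_apply]
  obtain ⟨s, hs, c, hc, hcm, hcy⟩ := exists_cone_weights hT hm
    (y := fun i => ε⁻¹ * (x i - t i * signVec x i i)) (fun i => by
      rw [abs_mul, abs_of_pos (inv_pos.2 h0), inv_mul_le_iff₀ h0, hsv, abs_le]
      simp only [ht]
      split_ifs with hxi
      · rw [abs_of_pos hxi]
        rcases max_cases (x i - ε * m) 0 with ⟨h, _⟩ | ⟨h, _⟩ <;> rw [h] <;> constructor <;> linarith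
      · rw [abs_of_nonpos (not_lt.1 hxi)]
        rcases max_cases (-x i - ε * m) 0 with ⟨h, _⟩ | ⟨h, _⟩ <;> rw [h] <;> constructor <;>
          linarith)
  set I := univ.filter (fun i => 0 < t i) with hI
  have hfacet : ∀ i ∈ I, ∀ v ∈ s, signVec x i ⬝ᵥ v = 1 := by
    intro i hi
    have hti : 0 < t i := (Finset.mem_filter.1 hi).2
    have hti' : t i = |x i| - ε * m := by
      simp only [ht] at hti ⊢
      exact max_eq_left ((lt_max_iff.1 hti).resolve_right (lt_irrefl 0)).le
    have hcyi : ∑ v ∈ s, c v * v i = ε⁻¹ * (x i - if 0 < x i then t i else -t i) := by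
      rw [← hsv]; simpa using congrFun hcy i
    rw [hti'] at hcyi
    refine eq_one_of_weighted_sum_eq hc ?_ ?_
    · intro v hv
      have := abs_le.1 (hs.subset_cube hT v hv i)
      unfold signVec
      split_ifs
      · rw [stdVec_dotProduct]; exact this.2
      · rw [neg_dotProduct, stdVec_dotProduct]; linarith
    · rw [hcm]
      unfold signVec
      split_ifs at hcyi ⊢ with hxi
      · simp only [stdVec_dotProduct]
        rw [hcyi, abs_of_pos hxi]
        field_simp
        ring
      · simp only [neg_dotProduct, stdVec_dotProduct, mul_neg, Finset.sum_neg_distrib]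
        rw [hcyi, abs_of_nonpos (not_lt.1 hxi)]
        field_simp
        ring
  set F := s.image (fun v => ε • v) ∪ I.image (signVec x) with hF
  have hFs : IsCollarSimplex ε s F := by
    intro z hz
    rcases Finset.mem_union.1 hz with hz | hz
    · obtain ⟨v, hv, rfl⟩ := Finset.mem_image.1 hz
      exact Or.inr ⟨v, hv, rfl⟩
    · obtain ⟨i, hi, rfl⟩ := Finset.mem_image.1 hz
      refine Or.inl ⟨signVec_mem_octLabels x i, fun hz => ?_, hfacet i hi⟩
      rcases Finset.mem_union.1 hz with hz | hz
      · obtain ⟨v, hv, h⟩ := Finset.mem_image.1 hz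
        exact smul_notMem_octLabels h0 h1 (hs.subset_cube hT v hv)
          (h ▸ neg_mem_octLabels (signVec_mem_octLabels x i))
      · obtain ⟨j, -, h⟩ := Finset.mem_image.1 hz
        exact neg_signVec_ne x i j h.symm
  have hIt : ∀ i ∈ univ, i ∉ I → t i = 0 := fun i hi hi' =>
    le_antisymm (not_lt.1 fun h => hi' (Finset.mem_filter.2 ⟨hi, h⟩)) (ht0 i)
  -- Indexing by a disjoint sum avoids checking injectivity and disjointness of the images forming
  -- `F`.
  have hmem : ∑ z ∈ s.disjSum I, (Sum.elim c t z) •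
      (Sum.elim (fun v => ε • v) (signVec x) z : Fin n → ℝ) ∈ convexHull ℝ (F : Set (Fin n → ℝ)) := by
    refine (convex_convexHull ℝ _).sum_mem ?_ ?_ ?_
    · rintro (v | i) hz
      · exact (hc v (Finset.inl_mem_disjSum.1 hz)).le
      · exact ht0 i
    · rw [Finset.sum_disjSum]
      simp only [Sum.elim_inl, Sum.elim_inr]
      rw [hcm, Finset.sum_subset (Finset.subset_univ I) hIt, add_comm]
      exact hsum
    · rintro (v | i) hz <;> refine subset_convexHull ℝ _ (Finset.mem_coe.2 ?_)
      · exact Finset.mem_union_left _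
          (Finset.mem_image_of_mem (fun v => ε • v) (Finset.inl_mem_disjSum.1 hz))
      · exact Finset.mem_union_right _
          (Finset.mem_image_of_mem (signVec x) (Finset.inr_mem_disjSum.1 hz))
  have hx' : ∑ z ∈ s.disjSum I, (Sum.elim c t z) •
      (Sum.elim (fun v => ε • v) (signVec x) z : Fin n → ℝ) = x := by
    rw [Finset.sum_disjSum]
    simp only [Sum.elim_inl, Sum.elim_inr]
    rw [Finset.sum_subset (Finset.subset_univ I) fun i hi hi' => by rw [hIt i hi hi', zero_smul],
      Finset.sum_congr rfl fun v _ => smul_comm (c v) ε v, ← Finset.smul_sum, hcy]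
    ext j
    rw [Pi.add_apply, Pi.smul_apply, smul_eq_mul, mul_inv_cancel_left₀ h0.ne', Finset.sum_apply,
      Finset.sum_eq_single j
        (fun i _ hij => by rw [Pi.smul_apply, signVec_apply_of_ne x hij.symm, smul_zero])
        (fun h => absurd (Finset.mem_univ j) h), Pi.smul_apply, smul_eq_mul, sub_add_cancel]
  rw [hx'] at hmem
  exact ⟨F, ⟨Finset.coe_nonempty.1 (convexHull_nonempty_iff.1 ⟨x, hmem⟩), s, hs, hFs⟩, hmem⟩

theorem collarComplex_space (hT : T.space = cube n) {ε : ℝ}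
    (h0 : 0 < ε) (h1 : ε < 1) (hε : n * ε < 1) :
    (collarComplex T hT ε h0 h1 hε).space = octahedron n := by
  refine Set.Subset.antisymm ?_ ?_
  · refine Set.iUnion₂_subset fun F hF => convexHull_min ?_ convex_octahedron
    obtain ⟨-, s, hs, hF⟩ := hF
    intro x hx
    rcases hF x hx with h | ⟨v, hv, rfl⟩
    · exact octLabels_subset_octahedron h.1
    · exact (sum_abs_smul_lt_one h0 hε (hs.subset_cube hT v hv)).le
  · intro x hx
    obtain ⟨F, hF, hxF⟩ := mem_collar_space hT h0 h1 hx
    exact Geometry.SimplicialComplex.mem_space_iff.2 ⟨F, hF, hxF⟩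

/-! ### The extended labelling and the conclusion. -/

open Classical in
/-- The extension of a labelling to the collar, in which each added vertex labels itself. -/
noncomputable def collarLabel (ε : ℝ) (lab : (Fin n → ℝ) → (Fin n → ℝ)) (x : Fin n → ℝ) :
    Fin n → ℝ :=
  if x ∈ octLabels n then x else lab (ε⁻¹ • x)

theorem collarLabel_of_mem {ε : ℝ} {lab : (Fin n → ℝ) → (Fin n → ℝ)} {x : Fin n → ℝ}
    (hx : x ∈ octLabels n) : collarLabel ε lab x = x :=
  if_pos hx

theorem collarLabel_smul {ε : ℝ} (h0 : 0 < ε) (h1 : ε < 1) {lab : (Fin n → ℝ) → (Fin n → ℝ)}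
    {v : Fin n → ℝ} (hv : v ∈ cube n) : collarLabel ε lab (ε • v) = lab v := by
  unfold collarLabel
  rw [if_neg (smul_notMem_octLabels h0 h1 hv), inv_smul_smul₀ h0.ne']

/-- A boundary-compatible labelling has no complementary edge between a vertex of the cube and a
label whose facet contains it. -/
theorem ne_neg_label_of_dotProduct_eq_one {lab : (Fin n → ℝ) → (Fin n → ℝ)} {l v : Fin n → ℝ}
    (hlab : ∀ i : Fin n, (v i = 1 ∨ v i = -1) → lab v ≠ -(v i • stdVec i))
    (hl : l ∈ octLabels n) (hlv : l ⬝ᵥ v = 1) : lab v ≠ -l := by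
  obtain ⟨i, rfl | rfl⟩ := hl
  · rw [stdVec_dotProduct] at hlv
    have := hlab i (Or.inl hlv)
    rwa [hlv, one_smul] at this
  · rw [neg_dotProduct, stdVec_dotProduct, neg_eq_iff_eq_neg] at hlv
    have := hlab i (Or.inr hlv)
    rwa [hlv, neg_smul, one_smul] at this

theorem cubicalSperner_of_octahedralSperner (hn : 1 ≤ n) (h : OctahedralSperner n) :
    CubicalSperner n := by
  intro T lab ⟨hfin, hT⟩ hlab hbd
  -- Any `ε` in `(0, 1)` with `n * ε < 1` would do.
  set ε : ℝ := ((n : ℝ) + 1)⁻¹ with hεdef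
  have hn' : (0 : ℝ) < n := Nat.cast_pos.2 hn
  have h0 : 0 < ε := by positivity
  have h1 : ε < 1 := inv_lt_one_of_one_lt₀ (by linarith)
  have hε : n * ε < 1 := by
    rw [hεdef, ← div_eq_mul_inv, div_lt_one (by linarith)]; linarith
  have hvert : ∀ x ∈ (collarComplex T hT ε h0 h1 hε).vertices,
      x ∈ octLabels n ∨ ∃ v ∈ T.vertices, x = ε • v := by
    rintro x ⟨-, s, hs, hF⟩
    rcases hF x (Finset.mem_singleton_self x) with h | ⟨v, hv, rfl⟩
    · exact Or.inl h.1
    · exact Or.inr ⟨v, hs.mem_vertices hv, rfl⟩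
  have hcube : ∀ v ∈ T.vertices, v ∈ cube n := fun v hv =>
    hT ▸ Geometry.SimplicialComplex.vertices_subset_space hv
  obtain ⟨F, ⟨-, s, hs, hF⟩, x, hx, y, hy, hxy⟩ :=
    h (collarComplex T hT ε h0 h1 hε) (collarLabel ε lab)
      ⟨collarFaces_finite hfin ε, collarComplex_space hT h0 h1 hε⟩
      (fun x hx => by
        rcases hvert x hx with hx | ⟨v, hv, rfl⟩
        · rw [collarLabel_of_mem hx]; exact hx
        · rw [collarLabel_smul h0 h1 (hcube v hv)]; exact hlab v hv)
      -- Only the labels can lie on the boundary: shrunk vertices have `ℓ₁` norm below 1.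
      (fun x hx hxf i => by
        rcases hvert x hx with hx | ⟨v, hv, rfl⟩
        · rw [collarLabel_of_mem hx]
          constructor <;> rintro hi rfl <;> simp [stdVec_apply] at hi <;> linarith
        · exact absurd hxf
            (notMem_frontier_octahedron (sum_abs_smul_lt_one h0 hε (hcube v hv))))
  have hsc := hs.subset_cube hT
  rcases hF x hx with ⟨hxo, hxF, hxs⟩ | ⟨v, hv, rfl⟩
  · rw [collarLabel_of_mem hxo] at hxy
    rcases hF y hy with ⟨hyo, -, -⟩ | ⟨u, hu, rfl⟩
    · rw [collarLabel_of_mem hyo] at hxy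
      exact absurd (by rwa [hxy, neg_neg]) hxF
    · rw [collarLabel_smul h0 h1 (hsc u hu)] at hxy
      exact absurd (neg_eq_iff_eq_neg.1 hxy.symm)
        (ne_neg_label_of_dotProduct_eq_one (hbd u (hs.mem_vertices hu)) hxo (hxs u hu))
  · rw [collarLabel_smul h0 h1 (hsc v hv)] at hxy
    rcases hF y hy with ⟨hyo, -, hys⟩ | ⟨u, hu, rfl⟩
    · rw [collarLabel_of_mem hyo] at hxy
      exact absurd hxy
        (ne_neg_label_of_dotProduct_eq_one (hbd v (hs.mem_vertices hv)) hyo (hys v hv))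
    · rw [collarLabel_smul h0 h1 (hsc u hu)] at hxy
      exact ⟨s, hs.mem_faces hv, v, hv, u, hu, hxy⟩

end SpernerLabels

theorem mainTheorem7 (n : ℕ) (hn : 1 ≤ n) :
    SpernerLabels.OctahedralSperner n → SpernerLabels.CubicalSperner n :=
  SpernerLabels.cubicalSperner_of_octahedralSperner hn
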